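/- For every integer $r\ge 2$ let $$f_r(z)=\sum_{n=0}^{\infty}\binom{2n}{n}^r z^n\in\mathbb{C}[[z]].$$ Then the power series $f_r$, $r\ge 2$, are algebraically independent over $\mathbb{C}(z)$: for every finite set $\{r_1,\dots,r_m\}$ of pairwise distinct integers $r_i\ge 2$ there is no non-zero polynomial $P\in\mathbb{C}(z)[Y_1,\dots,Y_m]$ such that $P(f_{r_1}(z),\dots,f_{r_m}(z))=0$. -/

import Mathlib

open scoped LaurentSeries RatFunc

/-- The power series `f_r(z) = ∑_{n ≥ 0} (binom(2n, n))^r z^n` with complex coefficients. -/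
noncomputable def centralBinomSeries (r : ℕ) : PowerSeries ℂ :=
  PowerSeries.mk fun n => ((Nat.choose (2 * n) n : ℕ) : ℂ) ^ r

/-! The proof combines congruences modulo `p` with the real singularities of the series. Arithmetic:
a relation over `ℂ(z)` descends to a linear relation over `ℤ[z]` between monomials in the `f_r`. By
Lucas, modulo `p` each monomial `F` satisfies `F = A * F ^ p` with `A` a polynomial, so `F ^ (p -
1)` is rational. A Kummer-type argument (`exists_proportional_of_linear_relation`) then makes two
distinct monomials proportional modulo `p`, with multipliers of degree bounded independently of `p`.
By pigeonhole one pair occurs for infinitely many `p`, and a pseudo-finite field of characteristic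
zero makes that pair proportional over `ℤ[z]`. Analysis: let `r` be the largest index where the two
exponents differ. Cancelling common factors gives `f_r ^ a * U = V` with `a > 0`, where `U` and `V`
converge beyond the radius `4 ^ (-r)` of `f_r`. At that point `f_r` grows at most logarithmically,
so `U` and `V` vanish there to the same order and `f_r` would continue analytically; but its `r`-th
derivative diverges (`pow_mul_ne_of_larger_radius`). -/

/-- The power series `∑ (binom(2n, n))^r z^n` with integer coefficients. -/
noncomputable def centralBinomIntSeries (r : ℕ) : PowerSeries ℤ :=
  PowerSeries.mk fun n => (n.centralBinom : ℤ) ^ r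

theorem coeff_centralBinomIntSeries (r n : ℕ) :
    PowerSeries.coeff n (centralBinomIntSeries r) = (n.centralBinom : ℤ) ^ r := by
  simp [centralBinomIntSeries]

theorem constantCoeff_centralBinomIntSeries (r : ℕ) :
    PowerSeries.constantCoeff (centralBinomIntSeries r) = 1 := by
  rw [← PowerSeries.coeff_zero_eq_constantCoeff_apply, coeff_centralBinomIntSeries]
  simp

theorem map_centralBinomIntSeries (r : ℕ) :
    PowerSeries.map (Int.castRingHom ℂ) (centralBinomIntSeries r) = centralBinomSeries r := by
  ext n
  simp [centralBinomIntSeries, centralBinomSeries, Nat.centralBinom]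

/-! ### Lucas congruences and the equation `F = A * F ^ p` -/

/-- Lucas' congruence for central binomial coefficients. -/
theorem cast_centralBinom_eq_mod_mul_div (p : ℕ) [hp : Fact p.Prime] (n : ℕ) :
    (n.centralBinom : ZMod p) = ((n % p).centralBinom : ZMod p) * ((n / p).centralBinom : ZMod p) := by
  have key : ∀ a b : ℕ, ((a.choose b : ℕ) : ZMod p) =
      ((a % p).choose (b % p) : ℕ) * ((a / p).choose (b / p) : ℕ) := by
    intro a b
    have := (ZMod.natCast_eq_natCast_iff _ _ p).2
      (Choose.choose_modEq_choose_mod_mul_choose_div_nat (n := a) (k := b) (p := p))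
    simpa using this
  have hp0 : 0 < p := hp.out.pos
  have hj : n % p < p := Nat.mod_lt _ hp0
  have hn : p * (n / p) + n % p = n := Nat.div_add_mod n p
  set m := n / p
  set j := n % p
  have hjj : j % p = j := Nat.mod_eq_of_lt hj
  have hjd : j / p = 0 := Nat.div_eq_of_lt hj
  simp only [Nat.centralBinom]
  rw [key (2 * n) n, key (2 * j) j, hjj, hjd]
  rcases lt_or_ge (2 * j) p with h | h
  · have h1 : 2 * n = 2 * j + p * (2 * m) := by rw [← hn]; ring
    have h2 : (2 * n) % p = 2 * j := by
      rw [h1, Nat.add_mul_mod_self_left, Nat.mod_eq_of_lt h]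
    have h3 : (2 * n) / p = 2 * m := by
      rw [h1, Nat.add_mul_div_left _ _ hp0, Nat.div_eq_of_lt h, zero_add]
    rw [h2, h3, Nat.mod_eq_of_lt h, Nat.div_eq_of_lt h]
    simp [m, j]
  -- A carry occurs: the last digit `2 * j - p` of `2 * n` is smaller than `j`, so both sides
  -- vanish.
  · have h0 : 2 * j = (2 * j - p) + p * 1 := by omega
    have h1 : 2 * n = (2 * j - p) + p * (2 * m + 1) := by
      have : 2 * n = 2 * j + p * (2 * m) := by rw [← hn]; ring
      rw [this, h0]; simp; ring
    have h4 : 2 * j - p < p := by omega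
    have h2 : (2 * n) % p = 2 * j - p := by
      rw [h1, Nat.add_mul_mod_self_left, Nat.mod_eq_of_lt h4]
    have h5 : (2 * j) % p = 2 * j - p := by
      conv_lhs => rw [h0]
      rw [Nat.add_mul_mod_self_left, Nat.mod_eq_of_lt h4]
    have h6 : (2 * j - p).choose j = 0 := Nat.choose_eq_zero_of_lt (by omega)
    have h7 : n % p = j := rfl
    rw [h2, h5, h7, h6]
    simp

theorem PowerSeries.pow_char_eq_expand (p : ℕ) [hp : Fact p.Prime] (F : PowerSeries (ZMod p)) :
    F ^ p = PowerSeries.expand p hp.out.ne_zero F := by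
  have h : frobenius (ZMod p) p = RingHom.id _ := ZMod.frobenius_zmod p
  have := MvPowerSeries.map_frobenius_expand p hp.out.ne_zero (f := F)
  rw [h, MvPowerSeries.map_id] at this
  exact this.symm

/-- A series with coefficients `u n` satisfying `u n = u (n % p) * u (n / p)` modulo `p`
satisfies `F = A * F ^ p` for a polynomial `A` of degree less than `p`. -/
theorem exists_polynomial_eq_mul_pow_of_lucas (p : ℕ) [hp : Fact p.Prime]
    (F : PowerSeries (ZMod p))
    (hF : ∀ n, PowerSeries.coeff n F =
      PowerSeries.coeff (n % p) F * PowerSeries.coeff (n / p) F) :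
    ∃ A : Polynomial (ZMod p), A.natDegree ≤ p - 1 ∧ F = (A : PowerSeries (ZMod p)) * F ^ p := by
  have hp0 : 0 < p := hp.out.pos
  -- Since `F ^ p = F(z ^ p)`, only the splitting `n = n % p + p * (n / p)` contributes to the
  -- `n`-th coefficient of the product.
  refine ⟨F.trunc p, ?_, ?_⟩
  · have := PowerSeries.natDegree_trunc_lt F (p - 1)
    rw [Nat.sub_add_cancel hp0] at this
    omega
  · rw [PowerSeries.pow_char_eq_expand]
    ext n
    rw [PowerSeries.coeff_mul, Finset.sum_eq_single (n % p, p * (n / p))]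
    · rw [hF n]
      simp [PowerSeries.coeff_trunc, Nat.mod_lt _ hp0]
    · rintro ⟨a, b⟩ hab hne
      simp only [Finset.HasAntidiagonal.mem_antidiagonal] at hab
      simp only [Polynomial.coeff_coe, PowerSeries.coeff_trunc, PowerSeries.coeff_expand]
      split_ifs with h1 h2
      · obtain ⟨c, rfl⟩ := h2
        exfalso
        apply hne
        have : n % p = a := by
          rw [← hab, Nat.add_mul_mod_self_left, Nat.mod_eq_of_lt h1]
        have h3 : n / p = c := by
          rw [← hab, Nat.add_mul_div_left _ _ hp0, Nat.div_eq_of_lt h1, zero_add]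
        rw [this, h3]
      all_goals simp
    · intro h
      exact absurd (Finset.HasAntidiagonal.mem_antidiagonal.2 (Nat.mod_add_div n p)) h

theorem exists_polynomial_map_centralBinomIntSeries (p : ℕ) [hp : Fact p.Prime] (r : ℕ) :
    ∃ A : Polynomial (ZMod p), A.natDegree ≤ p - 1 ∧
      PowerSeries.map (Int.castRingHom (ZMod p)) (centralBinomIntSeries r) =
        (A : PowerSeries (ZMod p)) *
          PowerSeries.map (Int.castRingHom (ZMod p)) (centralBinomIntSeries r) ^ p := by
  apply exists_polynomial_eq_mul_pow_of_lucas
  intro n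
  simp only [PowerSeries.coeff_map, coeff_centralBinomIntSeries]
  have := cast_centralBinom_eq_mod_mul_div p n
  simp [this, mul_pow]

/-! ### Linear relations in characteristic `p` -/

/-- Let `x i` be nonzero elements with `x i ^ p = g i * x i`, `g i` in a subfield `E`, in
characteristic `p`. If they satisfy a nontrivial linear relation over `E`, two of them
have ratio in `E`. -/
theorem exists_ratio_mem_of_linear_relation {E L σ : Type*} [Field E] [Field L] [Algebra E L]
    (p : ℕ) [hp : Fact p.Prime] [CharP E p] [CharP L p] (x : σ → L) (g : σ → E)
    (hx : ∀ i, x i ≠ 0) (hg : ∀ i, x i ^ p = algebraMap E L (g i) * x i)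
    (s : Finset σ) (hs : s.Nonempty) (q : σ → E) (hq : ∀ i ∈ s, q i ≠ 0)
    (hrel : ∑ i ∈ s, algebraMap E L (q i) * x i = 0) :
    ∃ i ∈ s, ∃ j ∈ s, i ≠ j ∧ ∃ e : E, x i = algebraMap E L e * x j := by
  classical
  induction hn : s.card using Nat.strong_induction_on generalizing s q with
  | _ n ih =>
  obtain ⟨i₀, hi₀⟩ := hs
  have hp1 : p - 1 + 1 = p := Nat.sub_add_cancel hp.out.pos
  have hfrob : ∑ i ∈ s, algebraMap E L (q i ^ p * g i) * x i = 0 := by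
    have := congrArg (· ^ p) hrel
    simp only [sum_pow_char, mul_pow, zero_pow hp.out.ne_zero, hg] at this
    rw [← this]
    refine Finset.sum_congr rfl fun i _ => ?_
    simp; ring
  -- The Frobenius image of the relation minus the multiple of the original that kills the term
  -- `i₀`: a shorter relation, unless it is trivial.
  let q' : σ → E := fun i => q i ^ p * g i - (q i₀ ^ (p - 1) * g i₀) * q i
  have hrel' : ∑ i ∈ s, algebraMap E L (q' i) * x i = 0 := by
    have : ∀ i, algebraMap E L (q' i) * x i = algebraMap E L (q i ^ p * g i) * x i -
        algebraMap E L (q i₀ ^ (p - 1) * g i₀) * (algebraMap E L (q i) * x i) := by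
      intro i; simp only [q', map_sub, map_mul]; ring
    simp only [this, Finset.sum_sub_distrib, ← Finset.mul_sum, hrel, hfrob]
    simp
  by_cases hall : ∀ i ∈ s, q' i = 0
  · obtain ⟨i, hi, hne⟩ : ∃ i ∈ s, i ≠ i₀ := by
      by_contra! h
      have : s = {i₀} := Finset.eq_singleton_iff_unique_mem.2 ⟨hi₀, h⟩
      rw [this, Finset.sum_singleton] at hrel
      exact (mul_ne_zero (by simpa using hq i₀ hi₀) (hx i₀)) hrel
    refine ⟨i, hi, i₀, hi₀, hne, ?_⟩
    have hy0 : algebraMap E L (q i₀) * x i₀ ≠ 0 := mul_ne_zero (by simpa using hq i₀ hi₀) (hx i₀)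
    set u := algebraMap E L (q i) * x i / (algebraMap E L (q i₀) * x i₀) with hu
    have hqi : q i ^ p * g i = (q i₀ ^ (p - 1) * g i₀) * q i := sub_eq_zero.1 (hall i hi)
    have hqi' : algebraMap E L (q i) ^ p * algebraMap E L (g i) =
        algebraMap E L (q i₀) ^ (p - 1) * algebraMap E L (g i₀) * algebraMap E L (q i) := by
      simpa using congrArg (algebraMap E L) hqi
    -- If the new relation is trivial, the ratio of two terms is fixed by Frobenius, hence lies in
    -- the prime field and so in `E`.
    have hup : u ^ p = u := by
      rw [hu, div_pow, div_eq_div_iff (pow_ne_zero _ hy0) hy0, mul_pow, mul_pow, hg, hg,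
        ← mul_assoc (algebraMap E L (q i) ^ p), hqi']
      have : algebraMap E L (q i₀) ^ p = algebraMap E L (q i₀) ^ (p - 1) * algebraMap E L (q i₀) := by
        rw [← pow_succ, hp1]
      rw [this]
      ring
    have hbot := (Subfield.mem_bot_iff_pow_eq_self L p).2 hup
    have hle : (⊥ : Subfield L) ≤ (algebraMap E L).fieldRange := bot_le
    obtain ⟨ζ, hζ⟩ := hle hbot
    have hqi0 : algebraMap E L (q i) ≠ 0 := by simpa using hq i hi
    refine ⟨ζ * q i₀ / q i, ?_⟩
    have hqi₀ : algebraMap E L (q i₀) ≠ 0 := by simpa using hq i₀ hi₀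
    have hx₀ := hx i₀
    rw [map_div₀, map_mul, hζ, hu]
    field_simp
  · push Not at hall
    obtain ⟨j, hj, hj0⟩ := hall
    let t := s.filter fun i => q' i ≠ 0
    have hi₀t : i₀ ∉ t := by
      simp only [t, Finset.mem_filter, not_and, not_not, q']
      intro _
      nth_rewrite 1 [← hp1]
      rw [pow_succ]; ring
    have hlt : t.card < n := by
      rw [← hn]
      refine Finset.card_lt_card ⟨Finset.filter_subset _ _, fun h => hi₀t (h hi₀)⟩
    have hsum : ∑ i ∈ t, algebraMap E L (q' i) * x i = 0 := by
      rw [← hrel', Finset.sum_filter]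
      refine Finset.sum_congr rfl fun i _ => ?_
      split_ifs with h
      · rfl
      · simp [not_not.1 h]
    obtain ⟨i, hi, k, hk, h⟩ := ih _ hlt t ⟨j, by simp [t, hj, hj0]⟩ q'
      (fun i hi => (Finset.mem_filter.1 hi).2) hsum rfl
    exact ⟨i, (Finset.mem_filter.1 hi).1, k, (Finset.mem_filter.1 hk).1, h⟩

/-- Let `F i` be nonzero power series over `ZMod p` with `F i = A i * F i ^ p` for polynomials `A i`
of degree at most `(p - 1) * d`. If they satisfy a nontrivial linear relation over the polynomials,
then two of them are proportional with factors of degree at most `d`. -/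
theorem exists_proportional_of_linear_relation {σ : Type*} (p : ℕ) [hp : Fact p.Prime] (d : ℕ)
    (s : Finset σ) (F : σ → PowerSeries (ZMod p)) (A : σ → Polynomial (ZMod p))
    (hF : ∀ i, F i ≠ 0) (hA : ∀ i ∈ s, (A i).natDegree ≤ (p - 1) * d)
    (hFA : ∀ i, F i = (A i : PowerSeries (ZMod p)) * F i ^ p)
    (q : σ → Polynomial (ZMod p)) (hq : ∃ i ∈ s, q i ≠ 0)
    (hrel : ∑ i ∈ s, (q i : PowerSeries (ZMod p)) * F i = 0) :
    ∃ i ∈ s, ∃ j ∈ s, i ≠ j ∧ ∃ u v : Polynomial (ZMod p), u.Monic ∧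
      u.natDegree ≤ d ∧ v.natDegree ≤ d ∧
      (u : PowerSeries (ZMod p)) * F i = (v : PowerSeries (ZMod p)) * F j := by
  classical
  let E := RatFunc (ZMod p)
  let L := LaurentSeries (ZMod p)
  have hp1 : p - 1 + 1 = p := Nat.sub_add_cancel hp.out.pos
  have hp2 : p - 1 ≠ 0 := by have := hp.out.two_le; omega
  have hA0 : ∀ i, A i ≠ 0 := fun i h => hF i (by rw [hFA i, h]; simp)
  have : CharP E p := charP_of_injective_algebraMap (algebraMap (ZMod p) E).injective p
  have : CharP L p := charP_of_injective_algebraMap (algebraMap E L).injective p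
  let ι : PowerSeries (ZMod p) →+* L := HahnSeries.ofPowerSeries ℤ (ZMod p)
  have hι : Function.Injective ι := HahnSeries.ofPowerSeries_injective
  have hcoe : ∀ P : Polynomial (ZMod p), ι (P : PowerSeries (ZMod p)) =
    algebraMap E L (algebraMap _ E P) := fun P => RatFunc.coe_coe P
  have hainj : Function.Injective (algebraMap (Polynomial (ZMod p)) E) :=
    RatFunc.algebraMap_injective _
  let t := s.filter fun i => q i ≠ 0
  have hsum : ∑ i ∈ t, algebraMap E L (algebraMap _ E (q i)) * ι (F i) = 0 := by
    rw [← map_zero ι, ← hrel, map_sum, Finset.sum_filter]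
    refine Finset.sum_congr rfl fun i _ => ?_
    split_ifs with h
    · rw [map_mul, hcoe]
    · simp [not_not.1 h]
  obtain ⟨i, hi, j, hj, hij, e, he⟩ := exists_ratio_mem_of_linear_relation (E := E) (L := L) p
    (fun i => ι (F i)) (fun i => (algebraMap _ E (A i))⁻¹)
    (fun i => (map_ne_zero_iff ι hι).2 (hF i))
    (fun i => by
      have h1 : algebraMap E L (algebraMap _ E (A i)) ≠ 0 := by
        rw [← hcoe]
        simpa [map_ne_zero_iff ι hι] using hA0 i
      rw [map_inv₀, eq_inv_mul_iff_mul_eq₀ h1, ← hcoe, ← map_pow, ← map_mul, ← hFA])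
    t (by obtain ⟨i, hi, h⟩ := hq; exact ⟨i, by simp [t, hi, h]⟩)
    (fun i => algebraMap _ E (q i))
    (fun i hi => by simpa [map_ne_zero_iff _ hainj] using (Finset.mem_filter.1 hi).2) hsum
  refine ⟨i, (Finset.mem_filter.1 hi).1, j, (Finset.mem_filter.1 hj).1, hij,
    e.denom, e.num, e.monic_denom, ?_⟩
  have heq : (e.denom : PowerSeries (ZMod p)) * F i = (e.num : PowerSeries (ZMod p)) * F j := by
    apply hι
    have hd : algebraMap _ E e.denom ≠ 0 := by
      simpa [map_ne_zero_iff _ hainj] using e.denom_ne_zero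
    rw [map_mul, map_mul, hcoe, hcoe, he, ← mul_assoc, ← map_mul]
    congr 2
    nth_rewrite 2 [← RatFunc.num_div_denom e]
    exact mul_div_cancel₀ _ hd
  -- Since `A k * F k ^ (p - 1) = 1`, the `(p - 1)`-st power of the proportionality involves
  -- polynomials only. Coprimality makes each `(p - 1)`-st power divide some `A k`, so the bound `(p
  -- - 1) * d` gives degree at most `d`.
  have hpow : e.denom ^ (p - 1) * A j = e.num ^ (p - 1) * A i := by
    apply Polynomial.coe_injective
    have h1 : ∀ k, (A k : PowerSeries (ZMod p)) * F k ^ (p - 1) = 1 := by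
      intro k
      apply mul_right_cancel₀ (hF k)
      rw [mul_assoc, ← pow_succ, hp1, ← hFA, one_mul]
    have h2 := congrArg (fun z => A i * (z ^ (p - 1)) * (A j : PowerSeries (ZMod p))) heq
    simp only [mul_pow] at h2
    push_cast
    linear_combination h2 - (e.denom : PowerSeries (ZMod p)) ^ (p - 1) * A j * h1 i +
      (e.num : PowerSeries (ZMod p)) ^ (p - 1) * A i * h1 j
  have hdeg : ∀ (a b c c' : Polynomial (ZMod p)), IsCoprime a b → a ^ (p - 1) * c =
      b ^ (p - 1) * c' → c' ≠ 0 → c'.natDegree ≤ (p - 1) * d → a.natDegree ≤ d := by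
    intro a b c c' hab h hc' hd
    have hdvd : a ^ (p - 1) ∣ c' := (hab.pow).dvd_of_dvd_mul_left ⟨c, h.symm⟩
    have := Polynomial.natDegree_le_of_dvd hdvd hc'
    rw [Polynomial.natDegree_pow] at this
    exact Nat.le_of_mul_le_mul_left (this.trans hd) (Nat.pos_of_ne_zero hp2)
  exact ⟨hdeg _ _ _ _ (RatFunc.isCoprime_num_denom e).symm hpow (hA0 i) (hA i (Finset.mem_filter.1 hi).1),
    hdeg _ _ _ _ (RatFunc.isCoprime_num_denom e) hpow.symm (hA0 j) (hA j (Finset.mem_filter.1 hj).1), heq⟩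

/-! ### Descent to integral coefficients -/

/-- A linear relation between integral power series with polynomial coefficients over a field of
characteristic zero descends to one with polynomial coefficients over `ℤ`. -/
theorem exists_int_relation {K σ : Type*} [Field K] [CharZero K] (s : Finset σ)
    (q : σ → Polynomial K) (g : σ → PowerSeries ℤ) (hq : ∃ i ∈ s, q i ≠ 0)
    (hrel : ∑ i ∈ s, (q i : PowerSeries K) * PowerSeries.map (Int.castRingHom K) (g i) = 0) :
    ∃ Q : σ → Polynomial ℤ, (∃ i ∈ s, Q i ≠ 0) ∧
      ∑ i ∈ s, (Q i : PowerSeries ℤ) * g i = 0 := by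
  classical
  obtain ⟨i₀, hi₀, hqi₀⟩ := hq
  obtain ⟨k₀, hk₀⟩ : ∃ k, (q i₀).coeff k ≠ 0 := by
    by_contra! h
    exact hqi₀ (Polynomial.ext h)
  -- A `ℚ`-linear functional applied coefficientwise preserves the relation, because the series are
  -- integral; this one keeps a chosen coefficient nonzero.
  obtain ⟨φ, hφ⟩ : ∃ φ : Module.Dual ℚ K, φ ((q i₀).coeff k₀) ≠ 0 := by
    by_contra! h
    exact hk₀ ((Module.forall_dual_apply_eq_zero_iff ℚ _).1 h)
  let N := s.sup (fun i => (q i).natDegree) + 1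
  have hN : ∀ i ∈ s, ∀ k, N ≤ k → (q i).coeff k = 0 := by
    intro i hi k hk
    refine Polynomial.coeff_eq_zero_of_natDegree_lt (lt_of_lt_of_le ?_ hk)
    exact Nat.lt_succ_of_le (Finset.le_sup (f := fun i => (q i).natDegree) hi)
  obtain ⟨b, hb⟩ := IsLocalization.exist_integer_multiples (nonZeroDivisors ℤ)
    (s ×ˢ Finset.range N) (fun x => φ ((q x.1).coeff x.2))
  have hb0 : ((b : ℤ) : ℚ) ≠ 0 := by
    exact_mod_cast nonZeroDivisors.ne_zero b.2
  have hex : ∀ i : σ, ∀ k : ℕ, ∃ z : ℤ, i ∈ s → (z : ℚ) = (b : ℤ) * φ ((q i).coeff k) := by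
    intro i k
    by_cases hi : i ∈ s
    · by_cases hk : k < N
      · obtain ⟨z, hz⟩ := hb (i, k) (Finset.mem_product.2 ⟨hi, Finset.mem_range.2 hk⟩)
        refine ⟨z, fun _ => ?_⟩
        simpa using hz
      · refine ⟨0, fun _ => ?_⟩
        rw [hN i hi k (not_lt.1 hk)]; simp
    · exact ⟨0, fun h => absurd h hi⟩
  choose z hz using hex
  let Q : σ → Polynomial ℤ := fun i => ∑ k ∈ Finset.range N, Polynomial.monomial k (z i k)
  have hQ : ∀ i ∈ s, ∀ k, ((Q i).coeff k : ℚ) = (b : ℤ) * φ ((q i).coeff k) := by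
    intro i hi k
    have : (Q i).coeff k = if k < N then z i k else 0 := by
      simp [Q, Polynomial.finsetSum_coeff, Polynomial.coeff_monomial]
    rw [this]
    split_ifs with h
    · exact hz i k hi
    · rw [hN i hi k (not_lt.1 h)]; simp
  have hmul : ∀ (c : K) (m : ℤ), φ (c * (m : K)) = φ c * (m : ℚ) := by
    intro c m
    rw [mul_comm, ← zsmul_eq_mul, map_zsmul, zsmul_eq_mul, mul_comm]
  refine ⟨Q, ⟨i₀, hi₀, ?_⟩, ?_⟩
  · intro h
    have := hQ i₀ hi₀ k₀
    rw [h] at this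
    exact mul_ne_zero hb0 hφ (by simpa using this.symm)
  · ext n
    have hn := congrArg (fun F => ((b : ℤ) : ℚ) * φ (PowerSeries.coeff n F)) hrel
    simp only [map_sum, PowerSeries.coeff_mul, Polynomial.coeff_coe, PowerSeries.coeff_map,
      eq_intCast, hmul, map_zero, mul_zero] at hn
    have : ((PowerSeries.coeff n (∑ i ∈ s, (Q i : PowerSeries ℤ) * g i) : ℤ) : ℚ) = 0 := by
      rw [← hn, map_sum, Int.cast_sum, Finset.mul_sum]
      refine Finset.sum_congr rfl fun i hi => ?_
      rw [PowerSeries.coeff_mul, Int.cast_sum, Finset.mul_sum]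
      refine Finset.sum_congr rfl fun x _ => ?_
      rw [Polynomial.coeff_coe, Int.cast_mul, hQ i hi, mul_assoc]
    exact_mod_cast this

/-- A pair of polynomial multipliers of bounded degree, one for each of infinitely many primes,
making `g` and `h` proportional modulo these primes, yields an integral pair. -/
theorem exists_int_proportional_of_infinite_primes (S : Set ℕ) (hS : S.Infinite)
    (hprime : ∀ p ∈ S, p.Prime) (d k : ℕ) (g h : PowerSeries ℤ)
    (hgh : ∀ p ∈ S, ∃ u v : Polynomial (ZMod p), u.Monic ∧ u.natDegree = k ∧ u.natDegree ≤ d ∧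
      v.natDegree ≤ d ∧
      (u : PowerSeries (ZMod p)) * PowerSeries.map (Int.castRingHom (ZMod p)) g =
        (v : PowerSeries (ZMod p)) * PowerSeries.map (Int.castRingHom (ZMod p)) h) :
    ∃ u v : Polynomial ℤ, (u ≠ 0 ∨ v ≠ 0) ∧ (u : PowerSeries ℤ) * g = (v : PowerSeries ℤ) * h := by
  classical
  choose! u v humonic huk hud hvd huv using hgh
  let R := (p : S) → ZMod (p : ℕ)
  have hfact : ∀ p : S, Fact (p : ℕ).Prime := fun p => ⟨hprime p p.2⟩
  let ev : (p : S) → R →+* ZMod (p : ℕ) := fun p => Pi.evalRingHom _ p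
  have hSinf : Infinite S := hS.to_subtype
  -- A maximal ideal above the finitely supported elements gives a residue field `K` that ignores
  -- any finite set of primes.
  let I : Ideal R :=
    { carrier := {x | {p : S | ev p x ≠ 0}.Finite}
      add_mem' := by
        intro a b ha hb
        refine (ha.union hb).subset fun p hp => ?_
        by_contra hc
        simp only [Set.mem_union, Set.mem_ofPred_eq, not_or, not_not] at hc
        exact hp (by rw [map_add, hc.1, hc.2, add_zero])
      zero_mem' := by simp
      smul_mem' := by
        intro c x hx
        refine Set.Finite.subset hx fun p hp hc => hp ?_
        rw [smul_eq_mul, map_mul, hc, mul_zero] }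
  have hI : I ≠ ⊤ := by
    intro htop
    have h1 : (1 : R) ∈ I := htop ▸ Submodule.mem_top
    have h2 : {p : S | ev p 1 ≠ 0} = Set.univ := by
      ext p; simp
    have h3 : {p : S | ev p 1 ≠ 0}.Finite := h1
    rw [h2] at h3
    exact Set.infinite_univ h3
  obtain ⟨M, hM, hIM⟩ := I.exists_le_maximal hI
  let K := R ⧸ M
  let _ : Field K := Ideal.Quotient.field M
  let π : R →+* K := Ideal.Quotient.mk M
  have : CharZero K := by
    refine charZero_of_inj_zero fun n hn => ?_
    by_contra hn0
    have hnM : (n : R) ∈ M := by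
      rw [← Ideal.Quotient.eq_zero_iff_mem, map_natCast]; exact hn
    -- The componentwise inverse of `n`, with value `0` at the finitely many primes dividing `n`;
    -- hence `n` is a unit modulo `I`.
    let y : R := fun p => (n : ZMod (p : ℕ))⁻¹
    have hyI : y * (n : R) - 1 ∈ I := by
      have : {p : S | ev p (y * (n : R) - 1) ≠ 0} ⊆
          (fun p : S => (p : ℕ)) ⁻¹' (n.divisors : Set ℕ) := by
        intro p hp
        simp only [Set.mem_preimage, Finset.mem_coe, Nat.mem_divisors]
        refine ⟨?_, hn0⟩
        by_contra hdvd
        apply hp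
        have : (n : ZMod (p : ℕ)) ≠ 0 := by
          rwa [Ne, ZMod.natCast_eq_zero_iff]
        have hy : ev p y = (n : ZMod (p : ℕ))⁻¹ := rfl
        rw [map_sub, map_mul, map_natCast, map_one, hy, inv_mul_cancel₀ this, sub_self]
      exact (Set.Finite.preimage Subtype.val_injective.injOn (Finset.finite_toSet _)).subset this
    have h1 : (1 : R) ∈ M := by
      have := M.sub_mem (M.mul_mem_left y hnM) (hIM hyI)
      simpa using this
    exact hM.ne_top ((Ideal.eq_top_iff_one M).2 h1)
  let lift : ((p : ℕ) → Polynomial (ZMod p)) → Polynomial R := fun w =>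
    ∑ j ∈ Finset.range (d + 1), Polynomial.monomial j (fun p : S => (w p).coeff j)
  have hlift : ∀ w : (p : ℕ) → Polynomial (ZMod p), (∀ p ∈ S, (w p).natDegree ≤ d) →
      ∀ p : S, (lift w).map (ev p) = w p := by
    intro w hw p
    conv_rhs => rw [(w p).as_sum_range' (d + 1) (Nat.lt_succ_of_le (hw p p.2))]
    simp only [lift, Polynomial.map_sum, Polynomial.map_monomial]
    rfl
  have hR : (lift u : PowerSeries R) * PowerSeries.map (Int.castRingHom R) g =
      (lift v : PowerSeries R) * PowerSeries.map (Int.castRingHom R) h := by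
    have hinj : ∀ F G : PowerSeries R, (∀ p : S,
        PowerSeries.map (ev p) F =
        PowerSeries.map (ev p) G) → F = G := by
      intro F G hFG
      refine PowerSeries.ext fun n => funext fun p => ?_
      have := congrArg (PowerSeries.coeff n) (hFG p)
      rwa [PowerSeries.coeff_map, PowerSeries.coeff_map] at this
    have hcomp : ∀ (p : S) (F : PowerSeries ℤ),
        PowerSeries.map (ev p)
          (PowerSeries.map (Int.castRingHom R) F) =
        PowerSeries.map (Int.castRingHom (ZMod (p : ℕ))) F := by
      intro p F
      ext n
      simp
    apply hinj
    intro p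
    rw [map_mul, map_mul, hcomp, hcomp, ← Polynomial.polynomial_map_coe,
      ← Polynomial.polynomial_map_coe, hlift u hud, hlift v hvd]
    exact huv p p.2
  have hK : ((lift u).map π : PowerSeries K) * PowerSeries.map (Int.castRingHom K) g =
      ((lift v).map π : PowerSeries K) * PowerSeries.map (Int.castRingHom K) h := by
    have hcomp : ∀ (F : PowerSeries ℤ), PowerSeries.map π (PowerSeries.map (Int.castRingHom R) F) =
        PowerSeries.map (Int.castRingHom K) F := by
      intro F
      ext n
      simp
    have := congrArg (PowerSeries.map π) hR
    rwa [map_mul, map_mul, hcomp, hcomp, ← Polynomial.polynomial_map_coe,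
      ← Polynomial.polynomial_map_coe] at this
  -- All `u p` are monic of the same degree `k`, so the coefficient of index `k` is `1` in every
  -- component and survives in `K`.
  have hne : (lift u).map π ≠ 0 := by
    intro h0
    obtain ⟨p₀, hp₀⟩ := hS.nonempty
    have hkd : k ≤ d := huk p₀ hp₀ ▸ hud p₀ hp₀
    have h1 : ((lift u).map π).coeff k = 1 := by
      rw [Polynomial.coeff_map, ← map_one π]
      congr 1
      have : (lift u).coeff k = fun p : S => (u p).coeff k := by
        simp [lift, Polynomial.finsetSum_coeff, Polynomial.coeff_monomial, hkd]
      rw [this]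
      funext p
      have := humonic p p.2
      rw [Polynomial.Monic, Polynomial.leadingCoeff, huk p p.2] at this
      exact this
    rw [h0] at h1
    simp at h1
  obtain ⟨Q, ⟨i, _, hQ⟩, hrel⟩ := exists_int_relation (K := K) (Finset.univ : Finset Bool)
    (fun b => if b then (lift u).map π else -(lift v).map π) (fun b => if b then g else h)
    ⟨true, Finset.mem_univ _, by simpa using hne⟩ (by
      simp only [Fintype.sum_bool, if_true, Bool.false_eq_true, if_false]
      rw [hK, Polynomial.coe_neg, neg_mul, add_neg_cancel])
  refine ⟨Q true, -Q false, ?_, ?_⟩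
  · cases i
    · exact Or.inr (neg_ne_zero.2 hQ)
    · exact Or.inl hQ
  · simp only [Fintype.sum_bool] at hrel
    simp only [if_true, Bool.false_eq_true, if_false] at hrel
    rw [Polynomial.coe_neg]
    linear_combination hrel

/-! ### From an algebraic relation to two proportional monomials -/

/-- An algebraic relation over `ℂ(z)` between integral power series gives a linear relation
with integral polynomial coefficients between monomials in them. -/
theorem exists_int_polynomial_relation {ι : Type*} (c : ι → PowerSeries ℤ)
    (h : ¬ AlgebraicIndependent (RatFunc ℂ) (fun i =>
      ((PowerSeries.map (Int.castRingHom ℂ) (c i) : PowerSeries ℂ) : ℂ⸨X⸩))) :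
    ∃ (s : Finset (ι →₀ ℕ)) (Q : (ι →₀ ℕ) → Polynomial ℤ), (∃ m ∈ s, Q m ≠ 0) ∧
      ∑ m ∈ s, (Q m : PowerSeries ℤ) * ∏ i ∈ m.support, c i ^ m i = 0 := by
  rw [algebraicIndependent_iff] at h
  push Not at h
  obtain ⟨P, hP, hP0⟩ := h
  obtain ⟨b, hb⟩ := IsLocalization.exist_integer_multiples (nonZeroDivisors (Polynomial ℂ))
    P.support (fun m => P.coeff m)
  have hb0 : algebraMap (Polynomial ℂ) (RatFunc ℂ) b ≠ 0 := by
    simp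
  choose! q hq using hb
  have hq' : ∀ m ∈ P.support, algebraMap (Polynomial ℂ) (RatFunc ℂ) (q m) =
      algebraMap (Polynomial ℂ) (RatFunc ℂ) b * P.coeff m := by
    intro m hm
    rw [hq m hm, Algebra.smul_def]
  obtain ⟨m₀, hm₀⟩ := MvPolynomial.support_nonempty.2 hP0
  refine ⟨P.support, exists_int_relation P.support q (fun m => ∏ i ∈ m.support, c i ^ m i)
    ⟨m₀, hm₀, ?_⟩ ?_⟩
  · intro h0
    have := hq' m₀ hm₀
    rw [h0, map_zero] at this
    exact mul_ne_zero hb0 (MvPolynomial.mem_support_iff.1 hm₀) this.symm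
  · apply HahnSeries.ofPowerSeries_injective (Γ := ℤ)
    rw [map_zero, map_sum]
    rw [MvPolynomial.aeval_def, MvPolynomial.eval₂_eq] at hP
    rw [← mul_zero (algebraMap (RatFunc ℂ) ℂ⸨X⸩ (algebraMap (Polynomial ℂ) (RatFunc ℂ) b)), ← hP,
      Finset.mul_sum]
    refine Finset.sum_congr rfl fun m hm => ?_
    have hcoe : HahnSeries.ofPowerSeries ℤ ℂ (q m) =
      algebraMap (RatFunc ℂ) ℂ⸨X⸩ (algebraMap (Polynomial ℂ) (RatFunc ℂ) (q m)) := RatFunc.coe_coe _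
    rw [map_mul, hcoe, hq' m hm, map_mul, mul_assoc]
    simp only [map_prod, map_pow]

/-- If integral power series `c i` satisfy `c i = A * (c i) ^ p` modulo every prime `p` for some
polynomial `A` of degree less than `p`, then an algebraic relation over `ℂ(z)` between them gives
two distinct monomials in them that are proportional over `ℤ[z]`. -/
theorem exists_proportional_monomials_of_not_algebraicIndependent {ι : Type*}
    (c : ι → PowerSeries ℤ) (hc : ∀ i, PowerSeries.constantCoeff (c i) = 1)
    (hL : ∀ (p : ℕ) [Fact p.Prime] (i : ι), ∃ A : Polynomial (ZMod p), A.natDegree ≤ p - 1 ∧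
      PowerSeries.map (Int.castRingHom (ZMod p)) (c i) =
        (A : PowerSeries (ZMod p)) * PowerSeries.map (Int.castRingHom (ZMod p)) (c i) ^ p)
    (h : ¬ AlgebraicIndependent (RatFunc ℂ) (fun i =>
      ((PowerSeries.map (Int.castRingHom ℂ) (c i) : PowerSeries ℂ) : ℂ⸨X⸩))) :
    ∃ m m' : ι →₀ ℕ, m ≠ m' ∧ ∃ u v : Polynomial ℤ, (u ≠ 0 ∨ v ≠ 0) ∧
      (u : PowerSeries ℤ) * ∏ i ∈ m.support, c i ^ m i =
        (v : PowerSeries ℤ) * ∏ i ∈ m'.support, c i ^ m' i := by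
  classical
  obtain ⟨s, Q, ⟨m₀, hm₀, hQ⟩, hrel⟩ := exists_int_polynomial_relation c h
  let d := s.sup fun m => ∑ i ∈ m.support, m i
  let T : (ι →₀ ℕ) × (ι →₀ ℕ) × ℕ → Set ℕ := fun x => {p | p.Prime ∧ x.1 ≠ x.2.1 ∧
    ∃ u v : Polynomial (ZMod p), u.Monic ∧ u.natDegree = x.2.2 ∧ u.natDegree ≤ d ∧
      v.natDegree ≤ d ∧
      (u : PowerSeries (ZMod p)) *
        PowerSeries.map (Int.castRingHom (ZMod p)) (∏ i ∈ x.1.support, c i ^ x.1 i) =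
      (v : PowerSeries (ZMod p)) *
        PowerSeries.map (Int.castRingHom (ZMod p)) (∏ i ∈ x.2.1.support, c i ^ x.2.1 i)}
  obtain ⟨k₀, hk₀⟩ : ∃ k, (Q m₀).coeff k ≠ 0 := by
    by_contra! h
    exact hQ (Polynomial.ext h)
  -- For `p` beyond a fixed nonzero coefficient of `Q m₀`, the relation stays nontrivial modulo `p`.
  have hmem : ∀ p : ℕ, p.Prime → ((Q m₀).coeff k₀).natAbs < p →
      p ∈ ⋃ x ∈ s ×ˢ s ×ˢ Finset.range (d + 1), T x := by
    intro p hp hlt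
    have : Fact p.Prime := ⟨hp⟩
    choose A hA hcA using fun i => hL p i
    obtain ⟨m, hm, m', hm', hne, u, v, hu, hud, hvd, huv⟩ :=
      exists_proportional_of_linear_relation p d s
      (fun m => PowerSeries.map (Int.castRingHom (ZMod p)) (∏ i ∈ m.support, c i ^ m i))
      (fun m => ∏ i ∈ m.support, A i ^ m i)
      (fun m h0 => by
        have hc' : ∀ i, PowerSeries.constantCoeff
            (PowerSeries.map (Int.castRingHom (ZMod p)) (c i)) = 1 := fun i => by
          rw [← PowerSeries.coeff_zero_eq_constantCoeff_apply, PowerSeries.coeff_map,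
            PowerSeries.coeff_zero_eq_constantCoeff_apply, hc, map_one]
        have := congrArg PowerSeries.constantCoeff h0
        simp [hc'] at this)
      (fun m hm => by
        refine (Polynomial.natDegree_prod_le _ _).trans ?_
        refine le_trans ?_ (Nat.mul_le_mul_left _
          (Finset.le_sup (f := fun m : ι →₀ ℕ => ∑ i ∈ m.support, m i) hm))
        rw [Finset.mul_sum]
        refine Finset.sum_le_sum fun i _ => Polynomial.natDegree_pow_le.trans ?_
        rw [mul_comm]
        exact Nat.mul_le_mul_right _ (hA i))
      (fun m => by
        have h1 : ((∏ i ∈ m.support, A i ^ m i : Polynomial (ZMod p)) : PowerSeries (ZMod p)) =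
            ∏ i ∈ m.support, (A i : PowerSeries (ZMod p)) ^ m i := by
          rw [← Polynomial.coeToPowerSeries.ringHom_apply, map_prod]
          simp
        rw [h1, map_prod, ← Finset.prod_pow, ← Finset.prod_mul_distrib]
        refine Finset.prod_congr rfl fun i _ => ?_
        rw [map_pow, ← pow_mul, mul_comm (m i) p, pow_mul, ← mul_pow, ← hcA])
      (fun m => (Q m).map (Int.castRingHom (ZMod p)))
      ⟨m₀, hm₀, fun h0 => by
        have h1 := congrArg (fun P => P.coeff k₀) h0
        simp only [Polynomial.coeff_map, Polynomial.coeff_zero, eq_intCast] at h1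
        rw [ZMod.intCast_zmod_eq_zero_iff_dvd, Int.natCast_dvd] at h1
        exact absurd (Nat.le_of_dvd (Int.natAbs_pos.2 hk₀) h1) (not_le.2 hlt)⟩
      (by
        have := congrArg (PowerSeries.map (Int.castRingHom (ZMod p))) hrel
        rw [map_sum, map_zero] at this
        rw [← this]
        refine Finset.sum_congr rfl fun m _ => ?_
        rw [map_mul, Polynomial.polynomial_map_coe])
    simp only [Set.mem_iUnion]
    exact ⟨(m, m', u.natDegree), by simp [hm, hm', Nat.lt_succ_of_le hud],
      hp, hne, u, v, hu, rfl, hud, hvd, huv⟩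
  -- Pigeonhole: the pairs of monomials and the degrees of `u` form a finite set, while the primes
  -- are infinite in number.
  obtain ⟨x, hx⟩ : ∃ x, (T x).Infinite := by
    by_contra! hfin
    have h1 : (⋃ x ∈ s ×ˢ s ×ˢ Finset.range (d + 1), T x).Finite :=
      Set.Finite.biUnion (Finset.finite_toSet _) fun x _ => hfin x
    refine Nat.infinite_setOfPred_prime ((h1.union (Set.finite_Iic ((Q m₀).coeff k₀).natAbs)).subset ?_)
    intro p hp
    by_cases hlt : ((Q m₀).coeff k₀).natAbs < p
    · exact Or.inl (hmem p hp hlt)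
    · exact Or.inr (not_lt.1 hlt)
  obtain ⟨p, hp⟩ := hx.nonempty
  exact ⟨x.1, x.2.1, hp.2.1, exists_int_proportional_of_infinite_primes (T x) hx
    (fun p hp => hp.1) d x.2.2 _ _ (fun p hp => hp.2.2)⟩

/-! ### Sums of real power series inside the interval of convergence -/

/-- The real power series `F` converges absolutely on the open disc of radius `R`. -/
def PowerSeries.AbsConvergesOn (F : PowerSeries ℝ) (R : ℝ) : Prop :=
  ∀ r : ℝ, 0 ≤ r → r < R → Summable fun n => |PowerSeries.coeff n F| * r ^ n

/-- The sum of a real power series at a point. -/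
noncomputable def PowerSeries.realSum (F : PowerSeries ℝ) (x : ℝ) : ℝ :=
  ∑' n, PowerSeries.coeff n F * x ^ n

namespace PowerSeries

variable {F G : PowerSeries ℝ} {R : ℝ}

theorem AbsConvergesOn.mono {R' : ℝ} (hF : F.AbsConvergesOn R) (h : R' ≤ R) :
    F.AbsConvergesOn R' := fun r h0 h1 => hF r h0 (h1.trans_le h)

theorem AbsConvergesOn.summable_norm (hF : F.AbsConvergesOn R) {x : ℝ} (hx : |x| < R) :
    Summable fun n => ‖coeff n F * x ^ n‖ := by
  simpa [abs_mul, abs_pow] using hF |x| (abs_nonneg x) hx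

theorem AbsConvergesOn.summable (hF : F.AbsConvergesOn R) {x : ℝ} (hx : |x| < R) :
    Summable fun n => coeff n F * x ^ n := (hF.summable_norm hx).of_norm

theorem coeff_mul_mul_pow (F G : PowerSeries ℝ) (x : ℝ) (n : ℕ) :
    coeff n (F * G) * x ^ n = ∑ kl ∈ Finset.HasAntidiagonal.antidiagonal n,
      (coeff kl.1 F * x ^ kl.1) * (coeff kl.2 G * x ^ kl.2) := by
  rw [coeff_mul, Finset.sum_mul]
  refine Finset.sum_congr rfl fun kl h => ?_
  rw [← Finset.HasAntidiagonal.mem_antidiagonal.1 h, pow_add]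
  ring

theorem AbsConvergesOn.mul (hF : F.AbsConvergesOn R) (hG : G.AbsConvergesOn R) :
    (F * G).AbsConvergesOn R := by
  intro r h0 h1
  have hr : |r| < R := by rwa [abs_of_nonneg h0]
  have := summable_norm_sum_mul_antidiagonal_of_summable_norm
    (hF.summable_norm hr) (hG.summable_norm hr)
  simp only [← coeff_mul_mul_pow] at this
  simpa [abs_mul, abs_pow, abs_of_nonneg h0] using this

theorem realSum_mul (hF : F.AbsConvergesOn R) (hG : G.AbsConvergesOn R) {x : ℝ} (hx : |x| < R) :
    (F * G).realSum x = F.realSum x * G.realSum x := by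
  simp only [realSum, coeff_mul_mul_pow]
  exact (tsum_mul_tsum_eq_tsum_sum_antidiagonal_of_summable_norm
    (hF.summable_norm hx) (hG.summable_norm hx)).symm

theorem absConvergesOn_polynomial (P : Polynomial ℝ) (R : ℝ) :
    (P : PowerSeries ℝ).AbsConvergesOn R := by
  intro r _ _
  refine summable_of_ne_finset_zero (s := P.support) fun n hn => ?_
  simp [Polynomial.notMem_support_iff.1 hn]

theorem absConvergesOn_one (R : ℝ) : (1 : PowerSeries ℝ).AbsConvergesOn R := by
  simpa using absConvergesOn_polynomial 1 R

theorem realSum_one (x : ℝ) : (1 : PowerSeries ℝ).realSum x = 1 := by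
  rw [realSum, tsum_eq_single 0]
  · simp
  · intro n hn
    simp [coeff_one, hn]

theorem AbsConvergesOn.pow (hF : F.AbsConvergesOn R) (n : ℕ) : (F ^ n).AbsConvergesOn R := by
  induction n with
  | zero => simpa using absConvergesOn_one R
  | succ n ih => rw [pow_succ]; exact ih.mul hF

theorem realSum_pow (hF : F.AbsConvergesOn R) {x : ℝ} (hx : |x| < R) (n : ℕ) :
    (F ^ n).realSum x = F.realSum x ^ n := by
  induction n with
  | zero => simpa using realSum_one x
  | succ n ih => rw [pow_succ, realSum_mul (hF.pow n) hF hx, ih, pow_succ]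

theorem absConvergesOn_prod {ι : Type*} (s : Finset ι) (f : ι → PowerSeries ℝ)
    (h : ∀ i ∈ s, (f i).AbsConvergesOn R) : (∏ i ∈ s, f i).AbsConvergesOn R :=
  Finset.prod_induction f (fun F => F.AbsConvergesOn R) (fun _ _ h h' => h.mul h')
    (absConvergesOn_one R) h

theorem AbsConvergesOn.hasFPowerSeriesOnBall (hF : F.AbsConvergesOn R) (hR : 0 < R) :
    HasFPowerSeriesOnBall F.realSum
      (FormalMultilinearSeries.ofScalars ℝ fun n => coeff n F) 0 (ENNReal.ofReal R) := by
  have hrad : ENNReal.ofReal R ≤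
      (FormalMultilinearSeries.ofScalars ℝ fun n => coeff n F).radius := by
    refine ENNReal.le_of_forall_nnreal_lt fun r hr => ?_
    refine FormalMultilinearSeries.le_radius_of_summable_norm _ ?_
    have hr' : (r : ℝ) < R := by
      rw [← ENNReal.ofReal_coe_nnreal] at hr
      exact (ENNReal.ofReal_lt_ofReal_iff hR).1 hr
    simpa [FormalMultilinearSeries.ofScalars_norm] using hF r r.2 hr'
  have hpos : 0 < ENNReal.ofReal R := ENNReal.ofReal_pos.2 hR
  have h := (FormalMultilinearSeries.hasFPowerSeriesOnBall
    (FormalMultilinearSeries.ofScalars ℝ fun n => coeff n F) (hpos.trans_le hrad)).mono hpos hrad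
  convert! h using 1
  funext x
  have := FormalMultilinearSeries.ofScalars_sum_eq (E := ℝ) (fun n => coeff n F) x
  simpa [realSum, FormalMultilinearSeries.ofScalarsSum] using this.symm

theorem AbsConvergesOn.analyticOnNhd (hF : F.AbsConvergesOn R) (hR : 0 < R) :
    AnalyticOnNhd ℝ F.realSum (Set.Ioo (-R) R) := by
  have := (hF.hasFPowerSeriesOnBall hR).analyticOnNhd
  rwa [Metric.eball_ofReal, Real.ball_eq_Ioo, zero_sub, zero_add] at this

/-- The sum of a nonzero power series does not vanish identically near a point of its interval
of convergence. -/
theorem AbsConvergesOn.not_eventually_eq_zero (hF : F.AbsConvergesOn R) (hF0 : F ≠ 0) {x : ℝ}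
    (hx : |x| < R) : ¬ ∀ᶠ y in nhds x, F.realSum y = 0 := by
  intro h
  have hR : 0 < R := (abs_nonneg x).trans_lt hx
  have h0 := (hF.analyticOnNhd hR).eqOn_zero_of_preconnected_of_eventuallyEq_zero
    isPreconnected_Ioo (abs_lt.1 hx) h
  have h1 : F.realSum =ᶠ[nhds 0] 0 :=
    h0.eventuallyEq_of_mem (Ioo_mem_nhds (neg_lt_zero.2 hR) hR)
  have h2 := (hF.hasFPowerSeriesOnBall hR).hasFPowerSeriesAt.eq_zero_of_eventually h1
  apply hF0
  ext n
  exact congrFun ((FormalMultilinearSeries.ofScalars_series_eq_zero ℝ).1 h2) n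

theorem AbsConvergesOn.derivative (hF : F.AbsConvergesOn R) :
    (PowerSeries.derivative ℝ F).AbsConvergesOn R := by
  intro r h0 h1
  obtain ⟨t, hrt, htR⟩ := exists_between h1
  have ht : 0 < t := h0.trans_lt hrt
  -- At an intermediate radius `t` the terms are bounded, so the differentiated series is dominated
  -- by a multiple of `∑ (n + 1) * (r / t) ^ n`.
  obtain ⟨C, hC⟩ := (hF t ht.le htR).tendsto_atTop_zero.bddAbove_range
  have hC' : ∀ n, |coeff n F| * t ^ n ≤ C := fun n => hC ⟨n, rfl⟩
  have hgeom : Summable fun n : ℕ => C / t * (((n : ℝ) ^ 1 * (r / t) ^ n) + (r / t) ^ n) := by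
    have hlt : ‖r / t‖ < 1 := by
      rw [Real.norm_of_nonneg (by positivity)]
      exact (div_lt_one ht).2 hrt
    exact ((summable_pow_mul_geometric_of_norm_lt_one 1 hlt).add
      (summable_geometric_of_norm_lt_one hlt)).mul_left _
  refine Summable.of_nonneg_of_le (fun n => by positivity) (fun n => ?_) hgeom
  rw [coeff_derivative, abs_mul, abs_of_nonneg (by positivity : (0 : ℝ) ≤ (n : ℝ) + 1)]
  have h2 : |coeff (n + 1) F| ≤ C / t ^ (n + 1) := by
    rw [le_div_iff₀ (by positivity)]
    exact hC' _
  calc |coeff (n + 1) F| * ((n : ℝ) + 1) * r ^ n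
      ≤ C / t ^ (n + 1) * ((n : ℝ) + 1) * r ^ n := by gcongr
    _ = C / t * (((n : ℝ) ^ 1 * (r / t) ^ n) + (r / t) ^ n) := by
      rw [div_pow, pow_succ]
      field_simp

theorem AbsConvergesOn.hasDerivAt (hF : F.AbsConvergesOn R) {x : ℝ} (hx : |x| < R) :
    HasDerivAt F.realSum ((PowerSeries.derivative ℝ F).realSum x) x := by
  obtain ⟨t, hxt, htR⟩ := exists_between hx
  have ht : 0 < t := (abs_nonneg x).trans_lt hxt
  have hsucc : (PowerSeries.derivative ℝ F).realSum x =
      ∑' n : ℕ, coeff n F * (n * x ^ (n - 1)) := by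
    have hd : ∀ n : ℕ, coeff n (PowerSeries.derivative ℝ F) * x ^ n =
        coeff (n + 1) F * ((n + 1 : ℕ) * x ^ (n + 1 - 1)) := fun n => by
      rw [coeff_derivative]
      simp [mul_assoc]
    have hs : Summable fun n : ℕ => coeff n F * (n * x ^ (n - 1)) := by
      rw [← summable_nat_add_iff 1]
      exact (hF.derivative.summable hx).congr hd
    rw [hs.tsum_eq_zero_add]
    simp only [realSum, hd]
    simp
  rw [hsucc]
  have hu : Summable fun n : ℕ => |coeff n F| * (n * t ^ (n - 1)) := by
    rw [← summable_nat_add_iff 1]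
    refine (hF.derivative t ht.le htR).congr fun n => ?_
    rw [coeff_derivative, abs_mul, abs_of_nonneg (by positivity : (0 : ℝ) ≤ (n : ℝ) + 1)]
    simp [mul_assoc]
  refine hasDerivAt_tsum_of_isPreconnected (t := Set.Ioo (-t) t) (y₀ := 0) hu isOpen_Ioo
    isPreconnected_Ioo (g := fun n z => coeff n F * z ^ n)
    (fun n y _ => (hasDerivAt_pow n y).const_mul _) (fun n y hy => ?_) (by simpa using ht)
    (hF.summable (by simpa using ht.trans htR)) (abs_lt.1 hxt)
  rw [norm_mul, norm_mul, norm_pow, Real.norm_eq_abs, Real.norm_eq_abs, Real.norm_eq_abs, Nat.abs_cast]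
  have := (abs_lt.2 hy).le
  gcongr

theorem AbsConvergesOn.iterate_derivative (hF : F.AbsConvergesOn R) (j : ℕ) :
    ((PowerSeries.derivative ℝ)^[j] F).AbsConvergesOn R := by
  induction j with
  | zero => simpa using hF
  | succ j ih => rw [Function.iterate_succ_apply']; exact ih.derivative

theorem AbsConvergesOn.iteratedDeriv_realSum (hF : F.AbsConvergesOn R) (j : ℕ) {x : ℝ}
    (hx : |x| < R) :
    iteratedDeriv j F.realSum x = ((PowerSeries.derivative ℝ)^[j] F).realSum x := by
  induction j generalizing x with
  | zero => simp
  | succ j ih =>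
    have : iteratedDeriv j F.realSum =ᶠ[nhds x] ((PowerSeries.derivative ℝ)^[j] F).realSum := by
      filter_upwards [Ioo_mem_nhds (abs_lt.1 hx).1 (abs_lt.1 hx).2] with y hy
      exact ih (abs_lt.2 hy)
    rw [iteratedDeriv_succ, this.deriv_eq, Function.iterate_succ_apply']
    exact ((hF.iterate_derivative j).hasDerivAt hx).deriv

end PowerSeries

/-! ### Behaviour at the radius of convergence -/

namespace PowerSeries

variable {F U V : PowerSeries ℝ} {ρ : ℝ}

theorem absConvergesOn_of_coeff_bound (hρ : 0 < ρ)
    (hF : ∀ n, |coeff n F| * ρ ^ n ≤ 1) : F.AbsConvergesOn ρ := by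
  intro r h0 h1
  refine Summable.of_nonneg_of_le (fun n => by positivity) (fun n => ?_)
    (summable_geometric_of_lt_one (div_nonneg h0 hρ.le) ((div_lt_one hρ).2 h1))
  calc |coeff n F| * r ^ n = (|coeff n F| * ρ ^ n) * (r / ρ) ^ n := by
        rw [div_pow]; field_simp
    _ ≤ 1 * (r / ρ) ^ n := by gcongr; exact hF n
    _ = (r / ρ) ^ n := one_mul _

theorem one_le_realSum (hF : F.AbsConvergesOn ρ) (hnn : ∀ n, 0 ≤ coeff n F)
    (h1 : constantCoeff F = 1) {x : ℝ} (h0 : 0 ≤ x) (hx : x < ρ) : 1 ≤ F.realSum x := by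
  have hs := hF.summable (x := x) (by rwa [abs_of_nonneg h0])
  have := hs.sum_le_tsum {0} fun n _ => mul_nonneg (hnn n) (pow_nonneg h0 n)
  simpa [realSum, h1] using this

/-- Termwise comparison with `∑ t ^ (n + 1) / (n + 1)`; the factor `t` on the left aligns the
exponents. -/
theorem realSum_le_neg_log (hρ : 0 < ρ) (hnn : ∀ n, 0 ≤ coeff n F)
    (hupper : ∀ n : ℕ, coeff n F * ρ ^ n ≤ 1 / (n + 1)) {t : ℝ} (ht : 0 < t) (ht1 : t < 1) :
    t * F.realSum (t * ρ) ≤ -Real.log (1 - t) := by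
  have hF : F.AbsConvergesOn ρ := absConvergesOn_of_coeff_bound hρ fun n => by
    rw [abs_of_nonneg (hnn n)]
    exact (hupper n).trans (div_le_one_of_le₀ (by linarith [n.cast_nonneg (α := ℝ)]) (by positivity))
  have hlog := Real.hasSum_pow_div_log_of_abs_lt_one (x := t) (by rwa [abs_of_pos ht])
  have hx : |t * ρ| < ρ := by
    rw [abs_of_pos (by positivity)]
    exact mul_lt_of_lt_one_left hρ ht1
  refine hasSum_le (fun n => ?_) ((hF.summable hx).hasSum.mul_left t) hlog
  calc t * (coeff n F * (t * ρ) ^ n) = t ^ (n + 1) * (coeff n F * ρ ^ n) := by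
        rw [mul_pow]; ring
    _ ≤ t ^ (n + 1) * (1 / (n + 1)) := by gcongr; exact hupper n
    _ = t ^ (n + 1) / (n + 1) := by ring

open Filter Topology

/-- A power of a logarithm is negligible against a simple zero. For `x > ρ / 2` the factor `t = x /
ρ` of `realSum_le_neg_log` costs at most `2`, whence the constant `2 ^ a * ρ`. -/
theorem tendsto_realSum_pow_mul_sub (hρ : 0 < ρ) (hnn : ∀ n, 0 ≤ coeff n F)
    (h1 : constantCoeff F = 1) (hupper : ∀ n : ℕ, coeff n F * ρ ^ n ≤ 1 / (n + 1)) (a : ℕ) :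
    Tendsto (fun x => F.realSum x ^ a * (x - ρ)) (𝓝[<] ρ) (𝓝 0) := by
  have hF : F.AbsConvergesOn ρ := absConvergesOn_of_coeff_bound hρ fun n => by
    rw [abs_of_nonneg (hnn n)]
    exact (hupper n).trans (div_le_one_of_le₀ (by linarith [n.cast_nonneg (α := ℝ)]) (by positivity))
  have hinv : Tendsto (fun x : ℝ => (1 - x / ρ)⁻¹) (𝓝[<] ρ) atTop := by
    refine Tendsto.inv_tendsto_nhdsGT_zero ?_
    refine tendsto_nhdsWithin_iff.2 ⟨?_, ?_⟩
    · have : Tendsto (fun x : ℝ => 1 - x / ρ) (𝓝 ρ) (𝓝 (1 - ρ / ρ)) := by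
        exact (continuous_const.sub (continuous_id.div_const ρ)).tendsto ρ
      rw [div_self hρ.ne', sub_self] at this
      exact this.mono_left nhdsWithin_le_nhds
    · filter_upwards [self_mem_nhdsWithin] with x hx
      exact sub_pos.2 ((div_lt_one hρ).2 hx)
  have hlim := (((Real.isLittleO_pow_log_id_atTop (n := a)).tendsto_div_nhds_zero.comp hinv).const_mul
    (2 ^ a * ρ))
  rw [mul_zero] at hlim
  refine squeeze_zero_norm' ?_ hlim
  filter_upwards [Ioo_mem_nhdsLT (half_lt_self hρ)] with x hx
  have hx0 : 0 < x := (half_pos hρ).trans hx.1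
  have ht1 : x / ρ < 1 := (div_lt_one hρ).2 hx.2
  have ht2 : 1 / 2 ≤ x / ρ := by rw [le_div_iff₀ hρ]; linarith [hx.1]
  have hone := one_le_realSum hF hnn h1 hx0.le hx.2
  have hle := realSum_le_neg_log hρ hnn hupper (div_pos hx0 hρ) ht1
  rw [div_mul_cancel₀ _ hρ.ne'] at hle
  have hle' : F.realSum x ≤ 2 * Real.log (1 - x / ρ)⁻¹ := by
    rw [Real.log_inv]
    nlinarith
  rw [norm_mul, norm_pow, Real.norm_of_nonneg (by linarith), Real.norm_of_nonpos (by linarith [hx.2])]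
  have : -(x - ρ) = ρ * (1 - x / ρ) := by field_simp; ring
  have hpos : 0 < 1 - x / ρ := by linarith
  rw [this]
  simp only [Function.comp, id]
  rw [div_inv_eq_mul]
  calc F.realSum x ^ a * (ρ * (1 - x / ρ))
      ≤ (2 * Real.log (1 - x / ρ)⁻¹) ^ a * (ρ * (1 - x / ρ)) := by gcongr
    _ = 2 ^ a * ρ * (Real.log (1 - x / ρ)⁻¹ ^ a * (1 - x / ρ)) := by rw [mul_pow]; ring

/-- A power series with nonnegative coefficients one of whose derivatives diverges at `ρ`
does not coincide on the left of `ρ` with a function analytic at `ρ`. -/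
theorem not_eventuallyEq_analyticAt (hρ : 0 < ρ) (hF : F.AbsConvergesOn ρ)
    (hnn : ∀ n, 0 ≤ coeff n F) (j : ℕ)
    (hj : ¬ Summable fun n => coeff n ((PowerSeries.derivative ℝ)^[j] F) * ρ ^ n)
    {φ : ℝ → ℝ} (hφ : AnalyticAt ℝ φ ρ) : ¬ F.realSum =ᶠ[𝓝[<] ρ] φ := by
  intro heq
  have hnn' : ∀ n, 0 ≤ coeff n ((PowerSeries.derivative ℝ)^[j] F) := fun n => by
    rw [coeff_iterate_derivative]
    exact mul_nonneg (Nat.cast_nonneg _) (hnn _)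
  have hcont : ContinuousAt (iteratedDeriv j φ) ρ := by
    rw [iteratedDeriv_eq_iterate]
    exact (hφ.iterated_deriv j).continuousAt
  have hder : ∀ᶠ x in 𝓝[<] ρ,
      iteratedDeriv j φ x = ((PowerSeries.derivative ℝ)^[j] F).realSum x := by
    obtain ⟨l, hl, hlφ⟩ := (mem_nhdsLT_iff_exists_Ioo_subset' (sub_one_lt ρ)).1 heq
    filter_upwards [Ioo_mem_nhdsLT hl, Ioo_mem_nhdsLT hρ] with x hx hx0
    rw [← hF.iteratedDeriv_realSum j (by rw [abs_of_pos hx0.1]; exact hx0.2)]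
    refine (Filter.EventuallyEq.iteratedDeriv_eq j ?_).symm
    filter_upwards [Ioo_mem_nhds hx.1 hx.2] with y hy
    exact hlφ hy
  apply hj
  -- By nonnegativity, partial sums at `x < ρ` are at most the `j`-th derivative of `φ` at `x`;
  -- letting `x` tend to `ρ` bounds those at `ρ`.
  refine summable_of_sum_range_le (c := iteratedDeriv j φ ρ)
    (fun n => mul_nonneg (hnn' n) (by positivity)) fun N => ?_
  have hpoly : Tendsto (fun x : ℝ => ∑ n ∈ Finset.range N,
      coeff n ((PowerSeries.derivative ℝ)^[j] F) * x ^ n) (𝓝[<] ρ)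
      (𝓝 (∑ n ∈ Finset.range N, coeff n ((PowerSeries.derivative ℝ)^[j] F) * ρ ^ n)) := by
    refine Tendsto.mono_left ?_ nhdsWithin_le_nhds
    exact (continuous_finsetSum _ fun n _ => continuous_const.mul (continuous_pow n)).tendsto ρ
  refine le_of_tendsto_of_tendsto hpoly (hcont.tendsto.mono_left nhdsWithin_le_nhds) ?_
  filter_upwards [hder, Ioo_mem_nhdsLT hρ] with x hx hx0
  rw [hx]
  exact ((hF.iterate_derivative j).summable (by rw [abs_of_pos hx0.1]; exact hx0.2)).sum_le_tsum _
    fun n _ => mul_nonneg (hnn' n) (pow_nonneg hx0.1.le n)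

/-- Let `F` have nonnegative coefficients, logarithmic growth at its radius of convergence `ρ`, and a
divergent derivative at `ρ`. Then no positive power of `F` is a quotient of power
series with larger radius of convergence. -/
theorem pow_mul_ne_of_larger_radius (hρ : 0 < ρ) (hnn : ∀ n, 0 ≤ coeff n F)
    (h1 : constantCoeff F = 1) (hupper : ∀ n : ℕ, coeff n F * ρ ^ n ≤ 1 / (n + 1)) (j : ℕ)
    (hj : ¬ Summable fun n => coeff n ((PowerSeries.derivative ℝ)^[j] F) * ρ ^ n)
    {R : ℝ} (hR : ρ < R) (hU : U.AbsConvergesOn R) (hV : V.AbsConvergesOn R)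
    (hU0 : U ≠ 0) (hV0 : V ≠ 0) {a : ℕ} (ha : a ≠ 0) : F ^ a * U ≠ V := by
  intro hrel
  have hF : F.AbsConvergesOn ρ := absConvergesOn_of_coeff_bound hρ fun n => by
    rw [abs_of_nonneg (hnn n)]
    exact (hupper n).trans (div_le_one_of_le₀ (by linarith [n.cast_nonneg (α := ℝ)]) (by positivity))
  have hR0 : 0 < R := hρ.trans hR
  have hρR : |ρ| < R := by rwa [abs_of_pos hρ]
  obtain ⟨m, g, hg, hg0, hmg⟩ := ((hU.analyticOnNhd hR0) ρ
    (abs_lt.1 hρR)).exists_eventuallyEq_pow_smul_nonzero_iff.2 (hU.not_eventually_eq_zero hU0 hρR)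
  obtain ⟨n, h, hh, hh0, hnh⟩ := ((hV.analyticOnNhd hR0) ρ
    (abs_lt.1 hρR)).exists_eventuallyEq_pow_smul_nonzero_iff.2 (hV.not_eventually_eq_zero hV0 hρR)
  have hone : ∀ᶠ x in 𝓝[<] ρ, 1 ≤ F.realSum x := by
    filter_upwards [Ioo_mem_nhdsLT hρ] with x hx
    exact one_le_realSum hF hnn h1 hx.1.le hx.2
  have hfun : ∀ᶠ x in 𝓝[<] ρ, F.realSum x ^ a * ((x - ρ) ^ m * g x) = (x - ρ) ^ n * h x := by
    filter_upwards [Ioo_mem_nhdsLT hρ, hmg.filter_mono nhdsWithin_le_nhds,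
      hnh.filter_mono nhdsWithin_le_nhds] with x hx hxU hxV
    have hxρ : |x| < ρ := by rw [abs_of_pos hx.1]; exact hx.2
    rw [smul_eq_mul] at hxU hxV
    rw [← hxU, ← hxV, ← hrel, realSum_mul (hF.pow a) (hU.mono hR.le) hxρ, realSum_pow hF hxρ]
  have hglim : Tendsto g (𝓝[<] ρ) (𝓝 (g ρ)) :=
    hg.continuousAt.tendsto.mono_left nhdsWithin_le_nhds
  have hhlim : Tendsto h (𝓝[<] ρ) (𝓝 (h ρ)) :=
    hh.continuousAt.tendsto.mono_left nhdsWithin_le_nhds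
  have hsub : Tendsto (fun x : ℝ => x - ρ) (𝓝[<] ρ) (𝓝 0) := by
    have : Tendsto (fun x : ℝ => x - ρ) (𝓝 ρ) (𝓝 (ρ - ρ)) :=
      (continuous_id.sub continuous_const).tendsto ρ
    rw [sub_self] at this
    exact this.mono_left nhdsWithin_le_nhds
  have hpow : ∀ k : ℕ, Tendsto (fun x : ℝ => (x - ρ) ^ (k + 1)) (𝓝[<] ρ) (𝓝 0) := fun k => by
    simpa using hsub.pow (k + 1)
  -- Here `m` and `n` are the vanishing orders of `U` and `V` at `ρ`. The bound `F ≥ 1` excludes `m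
  -- < n` and logarithmic growth excludes `n < m`.
  rcases lt_trichotomy m n with hmn | hmn | hmn
  · obtain ⟨k, rfl⟩ := Nat.exists_eq_add_of_lt hmn
    have hlim : Tendsto (fun x => |(x - ρ) ^ (k + 1) * h x|) (𝓝[<] ρ) (𝓝 0) := by
      simpa using ((hpow k).mul hhlim).abs
    have hle : |g ρ| ≤ 0 := by
      refine le_of_tendsto_of_tendsto hglim.abs hlim ?_
      filter_upwards [hfun, hone, self_mem_nhdsWithin] with x hx hx1 hxρ
      have hne : (x - ρ) ^ m ≠ 0 := pow_ne_zero _ (sub_ne_zero.2 (ne_of_lt hxρ))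
      have : F.realSum x ^ a * g x = (x - ρ) ^ (k + 1) * h x := by
        apply mul_left_cancel₀ hne
        rw [show m + k + 1 = m + (k + 1) by ring, pow_add] at hx
        linear_combination hx
      rw [← this, abs_mul, abs_of_nonneg (by positivity : 0 ≤ F.realSum x ^ a)]
      exact le_mul_of_one_le_left (abs_nonneg _) (one_le_pow₀ hx1)
    exact hg0 (abs_nonpos_iff.1 hle)
  · subst hmn
    have hquot : ∀ᶠ x in 𝓝[<] ρ, F.realSum x ^ a = h x / g x := by
      filter_upwards [hfun, self_mem_nhdsWithin, hglim.eventually_ne hg0] with x hx hxρ hgx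
      have hne : (x - ρ) ^ m ≠ 0 := pow_ne_zero _ (sub_ne_zero.2 (ne_of_lt hxρ))
      rw [eq_div_iff hgx]
      apply mul_left_cancel₀ hne
      linear_combination hx
    have hpos : 0 < h ρ / g ρ := by
      refine zero_lt_one.trans_le (ge_of_tendsto (hhlim.div hglim hg0) ?_)
      filter_upwards [hquot, hone] with x hx hx1
      rw [Pi.div_apply, ← hx]
      exact one_le_pow₀ hx1
    -- The positive `a`-th root of `h / g` is analytic at `ρ` and would continue `F` past `ρ`.
    have hφ : AnalyticAt ℝ (fun x => Real.exp (Real.log (h x / g x) / a)) ρ :=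
      (((hh.div hg hg0).log hpos).div analyticAt_const (Nat.cast_ne_zero.2 ha)).rexp'
    refine not_eventuallyEq_analyticAt hρ hF hnn j hj hφ ?_
    filter_upwards [hquot, hone] with x hx hx1
    rw [← hx, Real.log_pow, mul_div_cancel_left₀ _ (Nat.cast_ne_zero.2 ha),
      Real.exp_log (by linarith)]
  · obtain ⟨k, rfl⟩ := Nat.exists_eq_add_of_lt hmn
    have hlim : Tendsto (fun x => (F.realSum x ^ a * (x - ρ)) * ((x - ρ) ^ k * g x)) (𝓝[<] ρ)
        (𝓝 0) := by
      simpa using (tendsto_realSum_pow_mul_sub hρ hnn h1 hupper a).mul ((hsub.pow k).mul hglim)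
    refine hh0 (tendsto_nhds_unique (hhlim.congr' ?_) hlim)
    filter_upwards [hfun, self_mem_nhdsWithin] with x hx hxρ
    have hne : (x - ρ) ^ n ≠ 0 := pow_ne_zero _ (sub_ne_zero.2 (ne_of_lt hxρ))
    apply mul_left_cancel₀ hne
    rw [← hx]
    ring

end PowerSeries

/-! ### Growth of central binomial coefficients -/

/-- The power series `∑ (binom(2n, n))^r z^n` with real coefficients. -/
noncomputable def centralBinomRealSeries (r : ℕ) : PowerSeries ℝ :=
  PowerSeries.map (Int.castRingHom ℝ) (centralBinomIntSeries r)

theorem coeff_centralBinomRealSeries (r n : ℕ) :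
    PowerSeries.coeff n (centralBinomRealSeries r) = (n.centralBinom : ℝ) ^ r := by
  simp [centralBinomRealSeries, coeff_centralBinomIntSeries]

theorem constantCoeff_centralBinomRealSeries (r : ℕ) :
    PowerSeries.constantCoeff (centralBinomRealSeries r) = 1 := by
  rw [← PowerSeries.coeff_zero_eq_constantCoeff_apply, coeff_centralBinomRealSeries]
  simp

theorem centralBinomRealSeries_ne_zero (r : ℕ) : centralBinomRealSeries r ≠ 0 := fun h => by
  have := constantCoeff_centralBinomRealSeries r
  rw [h] at this
  simp at this

theorem coeff_centralBinomRealSeries_mul_pow (r n : ℕ) :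
    PowerSeries.coeff n (centralBinomRealSeries r) * ((1 / 4 : ℝ) ^ r) ^ n =
      ((n.centralBinom : ℝ) / 4 ^ n) ^ r := by
  rw [coeff_centralBinomRealSeries, ← pow_mul, mul_comm r n, pow_mul, ← mul_pow, one_div, inv_pow,
    div_eq_mul_inv]

/-- The factor `2 * n + 1` makes the induction close, through `(2n + 1)(2n + 3) ≤ 4(n + 1)^2`. -/
theorem centralBinom_sq_mul_le (n : ℕ) : n.centralBinom ^ 2 * (2 * n + 1) ≤ (4 ^ n) ^ 2 := by
  induction n with
  | zero => simp
  | succ n ih =>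
    have h := Nat.succ_mul_centralBinom_succ n
    have h2 : (n + 1) ^ 2 * ((n + 1).centralBinom ^ 2 * (2 * (n + 1) + 1)) ≤
        (n + 1) ^ 2 * (4 ^ (n + 1)) ^ 2 := by
      calc (n + 1) ^ 2 * ((n + 1).centralBinom ^ 2 * (2 * (n + 1) + 1))
          = ((n + 1) * (n + 1).centralBinom) ^ 2 * (2 * n + 3) := by ring
        _ = (4 * (2 * n + 1) * (2 * n + 3)) * (n.centralBinom ^ 2 * (2 * n + 1)) := by
          rw [h]; ring
        _ ≤ (16 * (n + 1) ^ 2) * (4 ^ n) ^ 2 := by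
          refine Nat.mul_le_mul ?_ ih
          nlinarith
        _ = (n + 1) ^ 2 * (4 ^ (n + 1)) ^ 2 := by ring
    exact Nat.le_of_mul_le_mul_left h2 (by positivity)

theorem centralBinom_div_sq_le (n : ℕ) :
    ((n.centralBinom : ℝ) / 4 ^ n) ^ 2 ≤ 1 / (n + 1) := by
  have h : ((n.centralBinom : ℝ)) ^ 2 * (2 * n + 1) ≤ (4 ^ n) ^ 2 := by
    exact_mod_cast centralBinom_sq_mul_le n
  rw [div_pow, div_le_div_iff₀ (by positivity) (by positivity), one_mul]
  refine le_trans ?_ h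
  gcongr
  linarith [n.cast_nonneg (α := ℝ)]

theorem centralBinom_div_le_one (n : ℕ) : (n.centralBinom : ℝ) / 4 ^ n ≤ 1 := by
  have h := (centralBinom_div_sq_le n).trans
    (div_le_one_of_le₀ (by linarith [n.cast_nonneg (α := ℝ)]) (by positivity))
  exact (sq_le_one_iff₀ (by positivity)).1 h

theorem absConvergesOn_centralBinomRealSeries (r : ℕ) :
    (centralBinomRealSeries r).AbsConvergesOn ((1 / 4) ^ r) := by
  refine PowerSeries.absConvergesOn_of_coeff_bound (by positivity) fun n => ?_
  rw [abs_of_nonneg (by rw [coeff_centralBinomRealSeries]; positivity),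
    coeff_centralBinomRealSeries_mul_pow]
  exact pow_le_one₀ (by positivity) (centralBinom_div_le_one n)

/-- This is where `r ≥ 2` is essential: for `r = 1` the decay is only of order `n ^ (-1/2)`, and the
series is the algebraic function `(1 - 4z) ^ (-1/2)`. -/
theorem coeff_centralBinomRealSeries_mul_pow_le {r : ℕ} (hr : 2 ≤ r) (n : ℕ) :
    PowerSeries.coeff n (centralBinomRealSeries r) * ((1 / 4 : ℝ) ^ r) ^ n ≤ 1 / (n + 1) := by
  rw [coeff_centralBinomRealSeries_mul_pow]
  exact (pow_le_pow_of_le_one (by positivity) (centralBinom_div_le_one n) hr).trans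
    (centralBinom_div_sq_le n)

/-- Differentiating `r` times gains a factor of at least `(n + 1) ^ r`, while the normalised
coefficient of index `n + r` is at least `(2 * (n + r)) ^ (-r)`; hence the terms do not tend to
zero. -/
theorem not_summable_iterate_derivative_centralBinomRealSeries {r : ℕ} (hr : r ≠ 0) :
    ¬ Summable fun n => PowerSeries.coeff n
      ((PowerSeries.derivative ℝ)^[r] (centralBinomRealSeries r)) * ((1 / 4 : ℝ) ^ r) ^ n := by
  intro h
  have hlower : ∀ n : ℕ, (1 / (2 * (r + 1)) : ℝ) ^ r ≤ PowerSeries.coeff n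
      ((PowerSeries.derivative ℝ)^[r] (centralBinomRealSeries r)) * ((1 / 4 : ℝ) ^ r) ^ n := by
    intro n
    have hm : 0 < n + r := by omega
    have h4 : (4 : ℝ) ^ (n + r) ≤ 2 * (n + r : ℕ) * (n + r).centralBinom := by
      exact_mod_cast Nat.four_pow_le_two_mul_self_mul_centralBinom (n + r) hm
    have hasc : ((n : ℝ) + 1) ^ r ≤ ((n + 1).ascFactorial r : ℝ) := by
      exact_mod_cast Nat.pow_succ_le_ascFactorial (n + 1) r
    have hcb : 1 / (2 * (n + r : ℕ) : ℝ) ≤ ((n + r).centralBinom : ℝ) / 4 ^ (n + r) := by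
      rw [div_le_div_iff₀ (by positivity) (by positivity)]
      linarith
    have hle1 : ((1 / 4 : ℝ) ^ r) ^ (n + r) ≤ ((1 / 4 : ℝ) ^ r) ^ n :=
      pow_le_pow_of_le_one (by positivity) (pow_le_one₀ (by norm_num) (by norm_num)) (by omega)
    rw [PowerSeries.coeff_iterate_derivative]
    calc (1 / (2 * (r + 1)) : ℝ) ^ r ≤ (((n : ℝ) + 1) * (1 / (2 * (n + r : ℕ)))) ^ r := by
          refine pow_le_pow_left₀ (by positivity) ?_ r
          rw [mul_one_div, div_le_div_iff₀ (by positivity) (by positivity)]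
          push_cast
          nlinarith [n.cast_nonneg (α := ℝ), r.cast_nonneg (α := ℝ),
            mul_nonneg (n.cast_nonneg (α := ℝ)) (r.cast_nonneg (α := ℝ))]
      _ = ((n : ℝ) + 1) ^ r * (1 / (2 * (n + r : ℕ))) ^ r := mul_pow _ _ _
      _ ≤ (n + 1).ascFactorial r * (((n + r).centralBinom : ℝ) / 4 ^ (n + r)) ^ r := by gcongr
      _ = (n + 1).ascFactorial r * (PowerSeries.coeff (n + r) (centralBinomRealSeries r) *
            ((1 / 4 : ℝ) ^ r) ^ (n + r)) := by rw [coeff_centralBinomRealSeries_mul_pow]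
      _ ≤ (n + 1).ascFactorial r * (PowerSeries.coeff (n + r) (centralBinomRealSeries r) *
            ((1 / 4 : ℝ) ^ r) ^ n) := by
          gcongr
          rw [coeff_centralBinomRealSeries]; positivity
      _ = _ := by ring
  have := ge_of_tendsto' h.tendsto_atTop_zero hlower
  have hpos : (0 : ℝ) < (1 / (2 * (r + 1)) : ℝ) ^ r := by positivity
  linarith

/-! ### Monomials are not proportional -/

/-- Two monomials in the central binomial series that differ, and for which the largest index of
a differing exponent carries a larger exponent on the left, are not proportional over the
polynomials. -/
theorem polynomial_mul_prod_centralBinomRealSeries_ne (S : Finset {r : ℕ // 2 ≤ r})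
    (m m' : {r : ℕ // 2 ≤ r} → ℕ) (r : {r : ℕ // 2 ≤ r}) (hr : r ∈ S) (hlt : m' r < m r)
    (hgt : ∀ i ∈ S, r < i → m i = m' i) (u v : Polynomial ℝ) (hu : u ≠ 0) (hv : v ≠ 0) :
    (u : PowerSeries ℝ) * ∏ i ∈ S, centralBinomRealSeries i ^ m i ≠
      (v : PowerSeries ℝ) * ∏ i ∈ S, centralBinomRealSeries i ^ m' i := by
  intro h
  have hsplit : ∀ e : {r : ℕ // 2 ≤ r} → ℕ, ∏ i ∈ S, centralBinomRealSeries i ^ e i =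
      centralBinomRealSeries r ^ e r *
        ((∏ i ∈ (S.erase r).filter (· < r), centralBinomRealSeries i ^ e i) *
        ∏ i ∈ (S.erase r).filter (¬ · < r), centralBinomRealSeries i ^ e i) := by
    intro e
    rw [Finset.prod_filter_mul_prod_filter_not]
    exact (Finset.mul_prod_erase S (fun i => centralBinomRealSeries i ^ e i) hr).symm
  -- Factors of index above `r` have smaller radius of convergence; they agree on both sides and are
  -- cancelled formally.
  have htail : ∏ i ∈ (S.erase r).filter (¬ · < r), centralBinomRealSeries i ^ m i =
      ∏ i ∈ (S.erase r).filter (¬ · < r), centralBinomRealSeries i ^ m' i := by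
    refine Finset.prod_congr rfl fun i hi => ?_
    rw [Finset.mem_filter, Finset.mem_erase] at hi
    rw [hgt i hi.1.2 (lt_of_le_of_ne (not_lt.1 hi.2) hi.1.1.symm)]
  have hne : ∀ (e : {r : ℕ // 2 ≤ r} → ℕ) (T : Finset {r : ℕ // 2 ≤ r}),
      ∏ i ∈ T, centralBinomRealSeries i ^ e i ≠ 0 := fun e T =>
    Finset.prod_ne_zero_iff.2 fun i _ => pow_ne_zero _ (centralBinomRealSeries_ne_zero i)
  have hpu : (u : PowerSeries ℝ) ≠ 0 := by simpa using hu
  have hpv : (v : PowerSeries ℝ) ≠ 0 := by simpa using hv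
  -- The radius `4 * (1 / 4) ^ r = (1 / 4) ^ (r - 1)` serves every index below `r`.
  have hconv : ∀ (P : Polynomial ℝ) (e : {r : ℕ // 2 ≤ r} → ℕ),
      ((P : PowerSeries ℝ) * ∏ i ∈ (S.erase r).filter (· < r),
        centralBinomRealSeries i ^ e i).AbsConvergesOn (4 * (1 / 4) ^ (r : ℕ)) := by
    intro P e
    refine (PowerSeries.absConvergesOn_polynomial P _).mul
      (PowerSeries.absConvergesOn_prod _ _ fun i hi => PowerSeries.AbsConvergesOn.pow ?_ _)
    refine (absConvergesOn_centralBinomRealSeries i).mono ?_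
    have hir : (i : ℕ) + 1 ≤ r := (Finset.mem_filter.1 hi).2
    calc (4 : ℝ) * (1 / 4) ^ (r : ℕ) ≤ 4 * (1 / 4) ^ ((i : ℕ) + 1) :=
          mul_le_mul_of_nonneg_left
            (pow_le_pow_of_le_one (by norm_num) (by norm_num) hir) (by norm_num)
      _ = (1 / 4) ^ (i : ℕ) := by rw [pow_succ]; ring
  have hρ : (0 : ℝ) < (1 / 4) ^ (r : ℕ) := by positivity
  refine PowerSeries.pow_mul_ne_of_larger_radius hρ
    (fun n => by rw [coeff_centralBinomRealSeries]; positivity)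
    (constantCoeff_centralBinomRealSeries r) (coeff_centralBinomRealSeries_mul_pow_le r.2) r
    (not_summable_iterate_derivative_centralBinomRealSeries (by have := r.2; omega))
    (R := 4 * (1 / 4) ^ (r : ℕ)) (by linarith) (hconv u m) (hconv v m')
    (mul_ne_zero hpu (hne _ _)) (mul_ne_zero hpv (hne _ _)) (a := m r - m' r) (by omega) ?_
  apply mul_left_cancel₀ (mul_ne_zero (pow_ne_zero (m' r) (centralBinomRealSeries_ne_zero r))
    (hne m' ((S.erase r).filter (¬ · < r))))
  rw [hsplit m, hsplit m', htail] at h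
  have hpow : centralBinomRealSeries r ^ m r =
      centralBinomRealSeries r ^ m' r * centralBinomRealSeries r ^ (m r - m' r) := by
    rw [← pow_add]; congr 1; omega
  rw [hpow] at h
  linear_combination h

theorem theorem5p4 :
    AlgebraicIndependent (RatFunc ℂ)
      (fun r : {r : ℕ // 2 ≤ r} => ((centralBinomSeries r.1 : PowerSeries ℂ) : ℂ⸨X⸩)) := by
  by_contra hdep
  simp only [← map_centralBinomIntSeries] at hdep
  obtain ⟨m, m', hne, u, v, huv, h⟩ := exists_proportional_monomials_of_not_algebraicIndependent
    (fun r : {r : ℕ // 2 ≤ r} => centralBinomIntSeries r)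
    (fun r => constantCoeff_centralBinomIntSeries r)
    (fun p _ r => exists_polynomial_map_centralBinomIntSeries p r) hdep
  let S := m.support ∪ m'.support
  have hS : ∀ e : {r : ℕ // 2 ≤ r} →₀ ℕ, e.support ⊆ S →
      PowerSeries.map (Int.castRingHom ℝ) (∏ i ∈ e.support, centralBinomIntSeries i ^ e i) =
        ∏ i ∈ S, centralBinomRealSeries i ^ e i := by
    intro e he
    rw [map_prod]
    simp only [map_pow]
    refine Finset.prod_subset he fun i _ hi => ?_
    rw [Finsupp.notMem_support_iff.1 hi, pow_zero]
  have hreal := congrArg (PowerSeries.map (Int.castRingHom ℝ)) h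
  rw [map_mul, map_mul, hS m Finset.subset_union_left, hS m' Finset.subset_union_right,
    ← Polynomial.polynomial_map_coe, ← Polynomial.polynomial_map_coe] at hreal
  set u' := u.map (Int.castRingHom ℝ)
  set v' := v.map (Int.castRingHom ℝ)
  have hprod : ∀ e : {r : ℕ // 2 ≤ r} →₀ ℕ, ∏ i ∈ S, centralBinomRealSeries i ^ e i ≠ 0 :=
    fun e => Finset.prod_ne_zero_iff.2 fun i _ => pow_ne_zero _ (centralBinomRealSeries_ne_zero i)
  have huv' : u' ≠ 0 ∨ v' ≠ 0 := huv.imp (Polynomial.map_ne_zero_iff Int.cast_injective).2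
    (Polynomial.map_ne_zero_iff Int.cast_injective).2
  -- The monomials are nonzero in a domain, so if one multiplier vanishes then so does the other.
  have hu : u' ≠ 0 := fun h0 => by
    rw [h0, Polynomial.coe_zero, zero_mul, eq_comm, mul_eq_zero] at hreal
    refine huv'.elim (fun hu => hu h0) fun hv => hreal.elim (fun h1 => hv ?_) (hprod m')
    simpa using h1
  have hv : v' ≠ 0 := fun h0 => by
    rw [h0, Polynomial.coe_zero, zero_mul, mul_eq_zero] at hreal
    refine huv'.elim (fun hu => hreal.elim (fun h1 => hu ?_) (hprod m)) (fun hv => hv h0)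
    simpa using h1
  have hD : (S.filter fun i => m i ≠ m' i).Nonempty := by
    obtain ⟨i, hi⟩ := DFunLike.ne_iff.1 hne
    refine ⟨i, Finset.mem_filter.2 ⟨?_, hi⟩⟩
    by_contra hiS
    simp only [S, Finset.mem_union, not_or, Finsupp.notMem_support_iff] at hiS
    exact hi (hiS.1.trans hiS.2.symm)
  obtain ⟨r, hrD, hmax⟩ := Finset.exists_max_image _ id hD
  rw [Finset.mem_filter] at hrD
  have hgt : ∀ i ∈ S, r < i → m i = m' i := by
    intro i hi hri
    by_contra hc
    exact absurd (hmax i (Finset.mem_filter.2 ⟨hi, hc⟩)) (not_le.2 hri)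
  rcases lt_or_gt_of_ne hrD.2 with hlt | hlt
  · exact polynomial_mul_prod_centralBinomRealSeries_ne S m' m r hrD.1 hlt
      (fun i hi hri => (hgt i hi hri).symm) v' u' hv hu hreal.symm
  · exact polynomial_mul_prod_centralBinomRealSeries_ne S m m' r hrD.1 hlt hgt u' v' hu hv hreal
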